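/- Let $s\ge 2$ be an integer (so $2^s\geq 4$) and let $m\geq 1$ be an odd integer. Call a vector $(v_0,v_1,\dots,v_{n-1})\in\mathbb{F}_2^n$ symmetric if $v_i=v_{n-i}$ for all $1\le i\le n-1$. Let $a=(a_0,\dots,a_{2^s-1})\in\mathbb{F}_2^{2^s}$ be a symmetric vector with $$a_0=1,\qquad a_{2^{s-1}}=0,\qquad \sum_{\substack{0\le i\le 2^{s-1}-1\\ \gcd(i,2)=1}}a_i=1,$$ and let $b=(b_0,\dots,b_{m-1})\in\mathbb{F}_2^m$ be a symmetric vector such that $\gcd\bigl(\sum_{i=0}^{m-1}b_ix^i,\;x^m-1\bigr)=1$ in $\mathbb{F}_2[x]$. Put $n=2^sm$. Then there exists a normal element $\gamma$ of $\mathbb{F}_{2^n}$ over $\mathbb{F}_2$ (that is, $\gamma,\gamma^2,\gamma^{2^2},\dots,\gamma^{2^{n-1}}$ form a basis of $\mathbb{F}_{2^n}$ over $\mathbb{F}_2$) whose corresponding vector $\bigl(\mathrm{Tr}_{\mathbb{F}_{2^n}/\mathbb{F}_2}(\gamma\cdot\gamma^{2^k})\bigr)_{0\le k\le n-1}$ is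 $(c_0,\dots,c_{n-1})$, where $$c_k=a_{k\bmod 2^s}\,b_{k\bmod m}\qquad (0\le k\le n-1).$$ -/

import Mathlib

/-- `α ∈ K` is a normal element of `K` over the finite field `F` with `q` elements: the conjugates
`α, α ^ q, …, α ^ (q ^ (n - 1))`, with `n = [K : F]`, form a basis of `K` over `F`. -/
def IsNormalElement (F : Type*) {K : Type*} [Field F] [Finite F] [Field K] [Algebra F K]
    (α : K) : Prop :=
  LinearIndependent F (fun i : Fin (Module.finrank F K) => α ^ (Nat.card F ^ (i : ℕ))) ∧
    Submodule.span F
      (Set.range fun i : Fin (Module.finrank F K) => α ^ (Nat.card F ^ (i : ℕ))) = ⊤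

/-- The corresponding vector of `α`, with entries `Tr (α * α ^ (q ^ i))` for `0 ≤ i ≤ n - 1`,
where `Tr` is the trace of `K` over the field `F` with `q` elements (and `n = [K : F]`). -/
noncomputable def correspondingVector (F : Type*) {K : Type*} [Field F] [Finite F] [Field K]
    [Algebra F K] (n : ℕ) (α : K) : Fin n → F :=
  fun i => Algebra.trace F K (α * α ^ (Nat.card F ^ (i : ℕ)))

/-- A vector `(a_0, …, a_{n-1})` is symmetric if `a_i = a_{n-i}` for `1 ≤ i ≤ n - 1`. -/
def IsSymmetricVector {R : Type*} {n : ℕ} (a : Fin n → R) : Prop :=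
  ∀ i j : Fin n, (i : ℕ) + (j : ℕ) = n → a i = a j

/-- The polynomial `a_0 + a_1 X + ⋯ + a_{n-1} X ^ (n - 1)` of a vector. -/
noncomputable def vectorPolynomial {R : Type*} [CommRing R] {n : ℕ} (a : Fin n → R) :
    Polynomial R :=
  ∑ i : Fin n, Polynomial.C (a i) * Polynomial.X ^ (i : ℕ)

open Module MonoidAlgebra
open scoped MonoidAlgebra IsMulCommutative

/-!
Over the group algebra `F[G]` of the Galois group, with the involution `h ↦ h*` inverting group
elements, let `⟨α, β⟩ = ∑ σ, Tr (α * σ β) σ`. An element `α` is normal exactly when `⟨α, α⟩` is a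
unit, the coefficients of `⟨α, α⟩` form the corresponding vector of `α`, and
`⟨h α, h α⟩ = h h* ⟨α, α⟩`. So prescribing the corresponding vector amounts to writing a given
quotient of two units fixed by `*` as a norm `h h*`.

In odd degree over `ZMod 2`, every `*`-fixed `v` is a norm: `v` is a square `z ^ 2`, where `z` is
again an iterated square of `v`, hence fixed by `*`. In degree `2 ^ s`, let `x` be the Frobenius
automorphism and `y = x + x*`, which is nilpotent. The symmetric vectors with the prescribed
entries and odd sum give units `1 + y + y ^ 2 t` with `t* = t`, and the corresponding vector of
every normal element is of this kind: its odd sum is computed through the trace to the quadratic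
subfield. A quotient of two such units has the form `1 + y ^ 2 t`, and this is a norm: solve
`q ^ 2 + q = y t` for a `*`-fixed `q` and take `h = 1 + q + q x`. As the trace is multiplicative on
products from two subfields of coprime degrees, the product of a solution in degree `2 ^ s` and one
in degree `m` is a solution in degree `2 ^ s * m`.
-/

section GroupAlgebra

variable {R G : Type*} [CommSemiring R] [CommGroup G]

variable (R G) in
/-- The involution `g ↦ g⁻¹` of the group algebra of a commutative group, extended linearly. -/
noncomputable def inversion : R[G] ≃ₐ[R] R[G] :=
  MonoidAlgebra.domCongr R R (MulEquiv.inv G)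

@[simp]
theorem inversion_single (g : G) (r : R) : inversion R G (single g r) = single g⁻¹ r := by
  simp [inversion]

theorem inversion_apply (h : R[G]) (g : G) : (inversion R G h).coeff g = h.coeff g⁻¹ := by
  simp [inversion]

@[simp]
theorem inversion_inversion (h : R[G]) : inversion R G (inversion R G h) = h := by
  ext g
  simp [inversion_apply]

theorem single_mul_inversion_single (g : G) :
    (single g 1 : R[G]) * inversion R G (single g 1) = 1 := by
  rw [inversion_single, MonoidAlgebra.single_mul_single, mul_inv_cancel, mul_one,
    MonoidAlgebra.one_def]

end GroupAlgebra

section TracePairing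

variable {F L : Type*} [Field F] [Field L] [Algebra F L]

variable (F L) in
/-- The action of the group algebra of the Galois group on the field, as endomorphisms. -/
noncomputable def galoisAction : F[Gal(L/F)] →ₐ[F] End F L :=
  (Representation.ofDistribMulAction F Gal(L/F) L).asAlgebraHom

@[simp]
theorem galoisAction_single (σ : Gal(L/F)) (r : F) (α : L) :
    galoisAction F L (single σ r) α = r • σ α := by
  simp [galoisAction, Representation.asAlgebraHom_single]

theorem galoisAction_apply_eq_sum [FiniteDimensional F L] (h : F[Gal(L/F)]) (α : L) :
    galoisAction F L h α = ∑ σ, h.coeff σ • σ α := by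
  classical
  induction h using MonoidAlgebra.induction_linear with
  | zero => simp
  | add g h hg hh => simp [hg, hh, add_smul, Finset.sum_add_distrib]
  | single σ r => simp [Finsupp.single_apply, ite_smul]

theorem linearIndependent_galois_iff [FiniteDimensional F L] {α : L} :
    (LinearIndependent F fun σ : Gal(L/F) => σ α) ↔
      ∀ h : F[Gal(L/F)], galoisAction F L h α = 0 → h = 0 := by
  simp only [Fintype.linearIndependent_iff, galoisAction_apply_eq_sum]
  refine ⟨fun hα h hh => ?_, fun hα r hr σ => ?_⟩
  · ext σ
    exact hα _ hh σ
  · have hsum : (∑ τ, single τ (r τ) : F[Gal(L/F)]).coeff = r := by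
      classical
      ext τ
      simp [Finsupp.single_apply]
    rw [← hsum, hα (∑ τ, single τ (r τ)) (by rwa [hsum])]
    rfl

variable [FiniteDimensional F L]

variable (F) in
/-- The pairing `∑ σ, Tr (α * σ β) σ` with values in the group algebra: its coefficients for
`α = β` are the entries of the corresponding vector of `α`. -/
noncomputable def tracePairing (α β : L) : F[Gal(L/F)] :=
  ∑ σ : Gal(L/F), single σ (Algebra.trace F L (α * σ β))

theorem tracePairing_coeff (α β : L) (σ : Gal(L/F)) :
    (tracePairing F α β).coeff σ = Algebra.trace F L (α * σ β) := by
  classical simp [tracePairing, Finsupp.single_apply]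

theorem tracePairing_add_left (α α' β : L) :
    tracePairing F (α + α') β = tracePairing F α β + tracePairing F α' β := by
  ext σ
  simp [tracePairing_coeff, add_mul]

@[simp]
theorem tracePairing_zero_left (β : L) : tracePairing F 0 β = 0 := by
  ext σ
  simp [tracePairing_coeff]

variable [IsAbelianGalois F L]

theorem inversion_tracePairing (α β : L) :
    inversion F Gal(L/F) (tracePairing F α β) = tracePairing F β α := by
  ext σ
  rw [inversion_apply, tracePairing_coeff, tracePairing_coeff,
    ← Algebra.trace_eq_of_algEquiv σ, map_mul]
  simp [mul_comm]

theorem tracePairing_galoisAction_left (h : F[Gal(L/F)]) (α β : L) :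
    tracePairing F (galoisAction F L h α) β = h * tracePairing F α β := by
  induction h using MonoidAlgebra.induction_linear with
  | zero => simp
  | add g h hg hh => simp [tracePairing_add_left, hg, hh, add_mul]
  | single σ r =>
    ext τ
    have trace_conj : Algebra.trace F L (σ α * τ β) = Algebra.trace F L (α * (σ⁻¹ * τ) β) := by
      rw [← Algebra.trace_eq_of_algEquiv σ (α * _), map_mul σ, ← AlgEquiv.mul_apply,
        mul_inv_cancel_left]
    simp [tracePairing_coeff, trace_conj]

theorem tracePairing_galoisAction_right (h : F[Gal(L/F)]) (α β : L) :
    tracePairing F α (galoisAction F L h β) = inversion F Gal(L/F) h * tracePairing F α β := by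
  rw [← inversion_tracePairing, tracePairing_galoisAction_left, map_mul, inversion_tracePairing]

theorem tracePairing_galoisAction_self (h : F[Gal(L/F)]) (α : L) :
    tracePairing F (galoisAction F L h α) (galoisAction F L h α) =
      h * inversion F Gal(L/F) h * tracePairing F α α := by
  rw [tracePairing_galoisAction_left, tracePairing_galoisAction_right, mul_assoc]

theorem isUnit_tracePairing_self_iff {α : L} :
    IsUnit (tracePairing F α α) ↔ LinearIndependent F fun σ : Gal(L/F) => σ α := by
  refine ⟨fun hunit => ?_, fun hα => ?_⟩
  · refine linearIndependent_galois_iff.mpr fun h hh => ?_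
    rw [← hunit.mul_left_eq_zero (b := tracePairing F α α), ← tracePairing_galoisAction_left, hh,
      tracePairing_zero_left]
  · have : IsArtinianRing F[Gal(L/F)] := IsArtinianRing.of_finite F _
    rw [IsArtinianRing.isUnit_iff_mem_nonZeroDivisors, mem_nonZeroDivisors_iff_right]
    intro h hh
    rw [← tracePairing_galoisAction_left] at hh
    refine linearIndependent_galois_iff.mp hα h ((traceForm_nondegenerate F L).1 _ ?_)
    have hspan : Submodule.span F (Set.range fun σ : Gal(L/F) => σ α) = ⊤ :=
      hα.span_eq_top_of_card_eq_finrank' (by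
        rw [← Nat.card_eq_fintype_card, IsGalois.card_aut_eq_finrank])
    refine LinearMap.congr_fun (LinearMap.ext_on_range hspan (g := 0) fun σ => ?_)
    rw [Algebra.traceForm_apply, ← tracePairing_coeff, hh]
    rfl

end TracePairing

section Frobenius

variable {F L : Type*} [Field F] [Finite F] [Field L] [Finite L] [Algebra F L] {n : ℕ}

instance isAbelianGalois_of_finite : IsAbelianGalois F L :=
  IsAbelianGalois.of_isCyclic F L

variable (F L) in
/-- The Frobenius automorphism `α ↦ α ^ q` of `L` over the field `F` with `q` elements. -/
noncomputable def galoisFrobenius : Gal(L/F) :=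
  letI := Fintype.ofFinite F
  FiniteField.frobeniusAlgEquivOfAlgebraic F L

theorem galoisFrobenius_pow_apply (k : ℕ) (α : L) :
    (galoisFrobenius F L ^ k) α = α ^ Nat.card F ^ k := by
  let _ := Fintype.ofFinite F
  rw [AlgEquiv.coe_pow, galoisFrobenius, FiniteField.coe_frobeniusAlgEquivOfAlgebraic_iterate,
    Nat.card_eq_fintype_card]

theorem galoisFrobenius_pow_finrank (hn : finrank F L = n) : galoisFrobenius F L ^ n = 1 := by
  let _ := Fintype.ofFinite F
  rw [← hn, ← FiniteField.orderOf_frobeniusAlgEquivOfAlgebraic F L]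
  exact pow_orderOf_eq_one _

theorem single_galoisFrobenius_pow_finrank (hn : finrank F L = n) :
    (single (galoisFrobenius F L) 1 : F[Gal(L/F)]) ^ n = 1 := by
  rw [MonoidAlgebra.single_pow, galoisFrobenius_pow_finrank hn, one_pow, MonoidAlgebra.one_def]

theorem galoisFrobenius_pow_bijective (hn : finrank F L = n) :
    Function.Bijective fun i : Fin n => galoisFrobenius F L ^ (i : ℕ) := by
  let _ := Fintype.ofFinite F
  let _ := Fintype.ofFinite L
  subst hn
  exact FiniteField.bijective_frobeniusAlgEquivOfAlgebraic_pow F L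

theorem isNormalElement_iff_linearIndependent {α : L} :
    IsNormalElement F α ↔ LinearIndependent F fun σ : Gal(L/F) => σ α := by
  have hconj : LinearIndependent F (fun i : Fin (finrank F L) => α ^ Nat.card F ^ (i : ℕ)) ↔
      LinearIndependent F fun σ : Gal(L/F) => σ α := by
    rw [← linearIndependent_equiv (Equiv.ofBijective _ (galoisFrobenius_pow_bijective rfl))]
    simp only [Function.comp_def, Equiv.ofBijective_apply, galoisFrobenius_pow_apply]
  rw [← hconj, IsNormalElement, and_iff_left_iff_imp]
  exact fun hli => hli.span_eq_top_of_card_eq_finrank' (Fintype.card_fin _)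

variable (L) in
/-- The element `∑ a_i φ ^ i` of the group algebra attached to a vector `a`, where `φ` is the
Frobenius automorphism. -/
noncomputable def frobeniusSum (a : Fin n → F) : F[Gal(L/F)] :=
  Polynomial.aeval (single (galoisFrobenius F L) 1) (vectorPolynomial a)

theorem frobeniusSum_eq_sum (a : Fin n → F) :
    frobeniusSum L a = ∑ i : Fin n, a i • single (galoisFrobenius F L) 1 ^ (i : ℕ) := by
  simp [frobeniusSum, vectorPolynomial, Algebra.smul_def]

theorem frobeniusSum_coeff (hn : finrank F L = n) (a : Fin n → F) (i : Fin n) :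
    (frobeniusSum L a).coeff (galoisFrobenius F L ^ (i : ℕ)) = a i := by
  classical
  have hinj := (galoisFrobenius_pow_bijective hn).injective
  simp [frobeniusSum_eq_sum, MonoidAlgebra.single_pow, Finsupp.single_apply,
    fun j : Fin n => hinj.eq_iff (a := j) (b := i)]

theorem tracePairing_self_eq_frobeniusSum_iff (hn : finrank F L = n) {α : L} {a : Fin n → F} :
    tracePairing F α α = frobeniusSum L a ↔ correspondingVector F n α = a := by
  have hcoeff (i : Fin n) : (tracePairing F α α).coeff (galoisFrobenius F L ^ (i : ℕ)) =
      correspondingVector F n α i := by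
    rw [tracePairing_coeff, galoisFrobenius_pow_apply, correspondingVector]
  refine ⟨fun h => ?_, fun h => ?_⟩
  · ext i
    rw [← hcoeff, h, frobeniusSum_coeff hn]
  · ext σ
    obtain ⟨i, rfl⟩ := (galoisFrobenius_pow_bijective hn).surjective σ
    rw [hcoeff, h, frobeniusSum_coeff hn]

theorem inversion_frobeniusSum (hn : finrank F L = n) {a : Fin n → F} (ha : IsSymmetricVector a) :
    inversion F Gal(L/F) (frobeniusSum L a) = frobeniusSum L a := by
  ext σ
  obtain ⟨i, rfl⟩ := (galoisFrobenius_pow_bijective hn).surjective σ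
  rw [inversion_apply]
  dsimp only
  rcases Nat.eq_zero_or_pos (i : ℕ) with hi | hi
  · rw [hi, pow_zero, inv_one]
  · let j : Fin n := ⟨n - i, by omega⟩
    have hij : (i : ℕ) + j = n := Nat.add_sub_cancel' i.2.le
    have hinv : (galoisFrobenius F L ^ (i : ℕ))⁻¹ = galoisFrobenius F L ^ (j : ℕ) := by
      rw [inv_eq_iff_mul_eq_one, ← pow_add, hij, galoisFrobenius_pow_finrank hn]
    rw [hinv, frobeniusSum_coeff hn, frobeniusSum_coeff hn, ha i j hij]

theorem isUnit_frobeniusSum_of_isCoprime (hn : finrank F L = n) {a : Fin n → F}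
    (ha : IsCoprime (vectorPolynomial a) (Polynomial.X ^ n - 1)) :
    IsUnit (frobeniusSum L a) := by
  have hX : Polynomial.aeval (single (galoisFrobenius F L) (1 : F))
      (Polynomial.X ^ n - 1 : Polynomial F) = 0 := by
    rw [map_sub, map_pow, Polynomial.aeval_X, single_galoisFrobenius_pow_finrank hn, map_one,
      sub_self]
  have h := ha.map (Polynomial.aeval (single (galoisFrobenius F L) (1 : F))).toRingHom
  rwa [AlgHom.toRingHom_eq_coe, RingHom.coe_coe, hX, isCoprime_zero_right] at h

theorem exists_isNormalElement_correspondingVector_eq (hn : finrank F L = n) {a : Fin n → F}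
    (ha : IsUnit (frobeniusSum L a)) {α : L} {g : F[Gal(L/F)]}
    (hg : g * inversion F Gal(L/F) g * tracePairing F α α = frobeniusSum L a) :
    ∃ γ : L, IsNormalElement F γ ∧ correspondingVector F n γ = a := by
  rw [← tracePairing_galoisAction_self] at hg
  refine ⟨galoisAction F L g α, ?_, (tracePairing_self_eq_frobeniusSum_iff hn).mp hg⟩
  rwa [isNormalElement_iff_linearIndependent, ← isUnit_tracePairing_self_iff, hg]

variable (F L) in
theorem exists_isNormalElement : ∃ α : L, IsNormalElement F α := by
  simp only [isNormalElement_iff_linearIndependent]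
  exact exists_linearIndependent_algEquiv_apply F L

end Frobenius

/-! ### Odd degree -/

theorem map_eq_self_of_mul_eq_one {R T : Type*} [CommMonoid R] [FunLike T R R]
    [MonoidHomClass T R R] (τ : T) {c d : R}
    (hcd : c * d = 1) (hc : τ c = c) : τ d = d := by
  have hτd : c * τ d = 1 := by rw [← hc, ← map_mul, hcd, map_one]
  exact (left_inv_eq_right_inv ((mul_comm d c).trans hcd) hτd).symm

instance charP_groupAlgebra {R G : Type*} [CommSemiring R] [Monoid G] (p : ℕ) [CharP R p] :
    CharP R[G] p :=
  charP_of_injective_algebraMap (FaithfulSMul.algebraMap_injective R R[G]) p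

theorem pow_prime_pow_eq_self {p k : ℕ} [Fact p.Prime] {G : Type*} [CommMonoid G]
    (hG : ∀ g : G, g ^ p ^ k = g) (v : (ZMod p)[G]) : v ^ p ^ k = v := by
  induction v using MonoidAlgebra.induction_linear with
  | zero => exact zero_pow (pow_ne_zero k (Fact.out : p.Prime).ne_zero)
  | add v w hv hw => rw [add_pow_char_pow, hv, hw]
  | single g r => rw [MonoidAlgebra.single_pow, hG, ZMod.pow_card_pow]

theorem exists_mul_inversion_eq_of_odd {G : Type*} [CommGroup G] (hG : Odd (Nat.card G))
    {v : (ZMod 2)[G]} (hv : inversion (ZMod 2) G v = v) :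
    ∃ z, z * inversion (ZMod 2) G z = v := by
  obtain ⟨k, hk⟩ : ∃ k, (Nat.card G).totient = k + 1 :=
    Nat.exists_eq_succ_of_ne_zero (Nat.totient_pos.mpr hG.pos).ne'
  have hpow (g : G) : g ^ 2 ^ (k + 1) = g := by
    have hmod : 2 ^ (k + 1) ≡ 1 [MOD Nat.card G] :=
      hk ▸ Nat.ModEq.pow_totient (Nat.coprime_two_left.mpr hG)
    rw [pow_eq_pow_of_modEq hmod pow_card_eq_one', pow_one]
  refine ⟨v ^ 2 ^ k, ?_⟩
  rw [map_pow, hv, ← pow_add, ← two_mul, ← pow_succ', pow_prime_pow_eq_self hpow]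

theorem exists_isNormalElement_correspondingVector_eq_of_odd {L : Type*} [Field L] [Finite L]
    [Algebra (ZMod 2) L] {m : ℕ} (hL : finrank (ZMod 2) L = m) (hm : Odd m) {b : Fin m → ZMod 2}
    (hsymm : IsSymmetricVector b)
    (hcoprime : IsCoprime (vectorPolynomial b) (Polynomial.X ^ m - 1)) :
    ∃ γ : L, IsNormalElement (ZMod 2) γ ∧ correspondingVector (ZMod 2) m γ = b := by
  obtain ⟨α, hα⟩ := exists_isNormalElement (ZMod 2) L
  rw [isNormalElement_iff_linearIndependent, ← isUnit_tracePairing_self_iff] at hα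
  obtain ⟨d, hd⟩ := hα.exists_right_inv
  have hτd : inversion (ZMod 2) Gal(L/ZMod 2) d = d :=
    map_eq_self_of_mul_eq_one (inversion (ZMod 2) Gal(L/ZMod 2)) hd (inversion_tracePairing α α)
  have hcard : Odd (Nat.card Gal(L/ZMod 2)) := by rwa [IsGalois.card_aut_eq_finrank, hL]
  obtain ⟨z, hz⟩ := exists_mul_inversion_eq_of_odd hcard
    (v := frobeniusSum L b * d) (by rw [map_mul, inversion_frobeniusSum hL hsymm, hτd])
  refine exists_isNormalElement_correspondingVector_eq hL
    (isUnit_frobeniusSum_of_isCoprime hL hcoprime) (α := α) (g := z) ?_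
  rw [hz, mul_assoc, mul_comm d, hd, mul_one]

/-! ### Norms in characteristic two -/

theorem map_add_map_eq_self {R T : Type*} [AddCommMonoid R] [FunLike T R R] [AddHomClass T R R]
    {τ : T} (hτ : ∀ z, τ (τ z) = z) (x : R) : τ (x + τ x) = x + τ x := by
  rw [map_add, hτ, add_comm]

theorem isUnit_one_add_add_sq_mul {R : Type*} [CommRing R] {y : R} (hy : IsNilpotent y) (t : R) :
    IsUnit (1 + y + y ^ 2 * t) := by
  have hnil : IsNilpotent (y * (1 + y * t)) := (Commute.all _ _).isNilpotent_mul_right hy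
  rw [show 1 + y + y ^ 2 * t = 1 + y * (1 + y * t) by ring]
  exact hnil.isUnit_one_add

section CharTwo

variable {R : Type*} [CommRing R] [CharP R 2]

theorem add_pow_two_pow_eq_zero {x z : R} {s : ℕ} (hx : x ^ 2 ^ s = 1) (hz : z ^ 2 ^ s = 1) :
    (x + z) ^ 2 ^ s = 0 := by
  rw [add_pow_char_pow, hx, hz, CharTwo.add_self_eq_zero]

theorem exists_sq_add_self_eq_of_isNilpotent (τ : R →+* R) {z : R} (hz : IsNilpotent z)
    (hτz : τ z = z) : ∃ q, τ q = q ∧ q ^ 2 + q = z := by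
  obtain ⟨k, hk⟩ := hz
  have telescope (n : ℕ) : (∑ j ∈ Finset.range n, z ^ 2 ^ j) ^ 2 +
      ∑ j ∈ Finset.range n, z ^ 2 ^ j = z ^ 2 ^ n + z := by
    induction n with
    | zero => simp [CharTwo.add_self_eq_zero]
    | succ n ih =>
      rw [Finset.sum_range_succ, CharTwo.add_sq, add_add_add_comm, ih, ← pow_mul, ← pow_succ]
      linear_combination z ^ 2 ^ n * (CharTwo.two_eq_zero : (2 : R) = 0)
  refine ⟨∑ j ∈ Finset.range k, z ^ 2 ^ j, by simp [hτz], ?_⟩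
  rw [telescope, pow_eq_zero_of_le Nat.lt_two_pow_self.le hk, zero_add]

variable {τ : R →+* R} {x : R}

theorem exists_mul_map_eq_one_add_sq_mul (hτ : ∀ z, τ (τ z) = z) (hx : x * τ x = 1)
    (hy : IsNilpotent (x + τ x)) {t : R} (ht : τ t = t) :
    ∃ g, g * τ g = 1 + (x + τ x) ^ 2 * t := by
  obtain ⟨q, hτq, hq⟩ := exists_sq_add_self_eq_of_isNilpotent τ
    ((Commute.all _ _).isNilpotent_mul_right hy : IsNilpotent ((x + τ x) * t))
    (by rw [map_mul, map_add_map_eq_self hτ, ht])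
  -- With `y = x + τ x`, the norm of `1 + q + q * x` is `1 + y * (q ^ 2 + q)`.
  refine ⟨1 + q + q * x, ?_⟩
  simp only [map_add, map_one, map_mul, hτq]
  linear_combination (x + τ x) * hq + q ^ 2 * hx +
    (q ^ 2 + q) * (CharTwo.two_eq_zero : (2 : R) = 0)

theorem exists_mul_map_mul_eq (hτ : ∀ z, τ (τ z) = z) (hx : x * τ x = 1)
    (hy : IsNilpotent (x + τ x)) {t t' : R} (ht : τ t = t) (ht' : τ t' = t') :
    ∃ g, g * τ g * (1 + (x + τ x) + (x + τ x) ^ 2 * t) =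
      1 + (x + τ x) + (x + τ x) ^ 2 * t' := by
  set y := x + τ x
  have hτy : τ y = y := map_add_map_eq_self hτ x
  obtain ⟨d, hd⟩ := (isUnit_one_add_add_sq_mul hy t).exists_right_inv
  have hτd : τ d = d := map_eq_self_of_mul_eq_one τ hd (by simp [hτy, ht])
  obtain ⟨g, hg⟩ := exists_mul_map_eq_one_add_sq_mul hτ hx hy (t := (t' - t) * d)
    (by simp [ht, ht', hτd])
  exact ⟨g, by linear_combination (1 + y + y ^ 2 * t) * hg + y ^ 2 * (t' - t) * hd⟩

theorem exists_pow_add_map_pow_eq (hτ : ∀ z, τ (τ z) = z) (hx : x * τ x = 1) (n : ℕ) :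
    ∃ t, τ t = t ∧ x ^ n + τ x ^ n = n * (x + τ x) + (x + τ x) ^ 2 * t := by
  have two_eq_zero : (2 : R) = 0 := CharTwo.two_eq_zero
  induction n using Nat.twoStepInduction with
  | zero => exact ⟨0, map_zero τ, by linear_combination two_eq_zero⟩
  | one => exact ⟨0, map_zero τ, by simp⟩
  | more n ih₀ ih₁ =>
    obtain ⟨t₀, ht₀, h₀⟩ := ih₀
    obtain ⟨t₁, ht₁, h₁⟩ := ih₁
    refine ⟨(n + 1) + (x + τ x) * t₁ - t₀, by simp [hτ, ht₀, ht₁, add_comm], ?_⟩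
    push_cast at h₁ ⊢
    linear_combination (x + τ x) * h₁ - h₀ - (x ^ n + τ x ^ n) * hx
      - (n + 1) * (x + τ x) * two_eq_zero

end CharTwo

/-! ### Corresponding vectors in degree divisible by four -/

/-- The conditions that characterise the corresponding vectors of the normal elements of an
extension of `ZMod 2` of degree `n`, for `n` a power of two with `4 ∣ n`. The entry of index `n / 2`
is addressed by `2 * i = n`, to avoid division. -/
structure IsTwoPowerTraceVector {n : ℕ} (a : Fin n → ZMod 2) : Prop where
  symm : IsSymmetricVector a
  zero (i : Fin n) : (i : ℕ) = 0 → a i = 1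
  half (i : Fin n) : 2 * (i : ℕ) = n → a i = 0
  sum_odd : ∑ i : Fin n with Odd i.val ∧ 2 * i.val < n, a i = 1

theorem sum_fin_eq_sum_add_neg {M : Type*} [AddCommMonoid M] {n : ℕ} [NeZero n] (f : Fin n → M) :
    ∑ i, f i = ∑ i with -i = i, f i + ∑ i with i < -i, (f i + f (-i)) := by
  have hneg : ∑ i : Fin n with i < -i, f (-i) = ∑ i with -i < i, f i :=
    Finset.sum_equiv (Equiv.neg (Fin n)) (by simp) (by simp)
  have hsplit : ∑ i with ¬ -i = i, f i = ∑ i with i < -i, f i + ∑ i with -i < i, f i := by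
    rw [← Finset.sum_filter_add_sum_filter_not (Finset.univ.filter fun i : Fin n => ¬ -i = i)
      (fun i => i < -i), Finset.filter_filter, Finset.filter_filter]
    congr 2 <;> ext i <;>
      simp only [Finset.mem_filter, Finset.mem_univ, true_and] <;> grind
  rw [Finset.sum_add_distrib, hneg, ← hsplit, Finset.sum_filter_add_sum_filter_not]

theorem fin_val_neg_of_pos {n : ℕ} [NeZero n] {i : Fin n} (hi : 0 < (i : ℕ)) :
    ((-i : Fin n) : ℕ) = n - i := by
  rw [Fin.val_neg, if_neg (by rintro rfl; simp at hi)]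

theorem fin_lt_neg_iff {n : ℕ} [NeZero n] {i : Fin n} : i < -i ↔ 0 < (i : ℕ) ∧ 2 * (i : ℕ) < n := by
  rcases Nat.eq_zero_or_pos (i : ℕ) with hi | hi
  · obtain rfl : i = 0 := Fin.ext hi
    simp
  · rw [Fin.lt_def, fin_val_neg_of_pos hi]
    omega

theorem fin_neg_eq_self_iff {n : ℕ} [NeZero n] {i : Fin n} :
    -i = i ↔ i = 0 ∨ 2 * (i : ℕ) = n := by
  rcases Nat.eq_zero_or_pos (i : ℕ) with hi | hi
  · obtain rfl : i = 0 := Fin.ext hi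
    simp
  · rw [Fin.ext_iff, Fin.ext_iff, fin_val_neg_of_pos hi, Fin.val_zero]
    omega

theorem filter_odd_lt_half_eq {n : ℕ} [NeZero n] :
    (Finset.univ.filter fun i : Fin n => Odd i.val ∧ 2 * i.val < n) =
      (Finset.univ.filter fun i : Fin n => i < -i).filter fun i => Odd i.val := by
  ext i
  have hpos : Odd i.val → 0 < i.val := Odd.pos
  simp only [Finset.mem_filter, Finset.mem_univ, true_and, fin_lt_neg_iff]
  tauto

theorem sum_odd_lt_half_add_eq {M : Type*} [AddCommMonoid M] {n : ℕ} [NeZero n] (hn : 4 ∣ n)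
    (f : ℕ → M) :
    ∑ i : Fin n with Odd i.val ∧ 2 * i.val < n, (f i + f (n - i)) =
      ∑ i ∈ Finset.range n with Odd i, f i := by
  let g (i : Fin n) : M := if Odd i.val then f i else 0
  have hfixed : ∑ i with -i = i, g i = 0 := by
    refine Finset.sum_eq_zero fun i hi => if_neg ?_
    rcases fin_neg_eq_self_iff.mp (Finset.mem_filter.mp hi).2 with rfl | hi
    · simp
    · grind
  have hpair (i : Fin n) (hi : i < -i) :
      g i + g (-i) = if Odd i.val then f i + f (n - i) else 0 := by
    have hodd : Odd (n - i.val) ↔ Odd i.val := by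
      rw [Nat.odd_sub i.2.le]
      grind
    simp only [g, fin_val_neg_of_pos (fin_lt_neg_iff.mp hi).1, hodd]
    split_ifs <;> simp
  rw [filter_odd_lt_half_eq, Finset.sum_filter (p := fun i : Fin n => Odd i.val),
    Finset.sum_filter (p := Odd), ← Fin.sum_univ_eq_sum_range (fun i => if Odd i then f i else 0),
    sum_fin_eq_sum_add_neg, hfixed, zero_add]
  exact Finset.sum_congr rfl fun i hi => (hpair i (Finset.mem_filter.mp hi).2).symm

theorem sum_lt_neg_mul_natCast_eq {n : ℕ} [NeZero n] (a : Fin n → ZMod 2) :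
    ∑ i with i < -i, a i * ((i : ℕ) : ZMod 2) =
      ∑ i : Fin n with Odd i.val ∧ 2 * i.val < n, a i := by
  rw [filter_odd_lt_half_eq, Finset.sum_filter (p := fun i : Fin n => Odd i.val)]
  refine Finset.sum_congr rfl fun i _ => ?_
  split_ifs with hi
  · rw [ZMod.natCast_eq_one_iff_odd.mpr hi, mul_one]
  · rw [ZMod.natCast_eq_zero_iff_even.mpr (Nat.not_odd_iff_even.mp hi), mul_zero]

section GaloisTrace

variable {F L : Type*} [Field F] [Field L] [Algebra F L] [FiniteDimensional F L] [IsGalois F L]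

theorem trace_ne_zero_of_linearIndependent {α : L}
    (hα : LinearIndependent F fun σ : Gal(L/F) => σ α) : Algebra.trace F L α ≠ 0 := by
  intro h
  have hsum : ∑ σ : Gal(L/F), (1 : F) • σ α = 0 := by
    simp only [one_smul, ← trace_eq_sum_automorphisms, h, map_zero]
  exact one_ne_zero (Fintype.linearIndependent_iff.mp hα _ hsum 1)

theorem trace_mul_apply_eq_zero_of_sq_eq_one [CharP L 2] {σ : Gal(L/F)} (hσ : σ ^ 2 = 1)
    (hσ1 : σ ≠ 1) (α : L) : Algebra.trace F L (α * σ α) = 0 := by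
  have hσσ (τ : Gal(L/F)) : τ * σ * σ = τ := by rw [mul_assoc, ← sq, hσ, mul_one]
  apply (algebraMap F L).injective
  rw [trace_eq_sum_automorphisms, map_zero]
  refine Finset.sum_involution (fun τ _ => τ * σ) (fun τ _ => ?_) (fun τ _ _ => ?_)
    (fun τ _ => Finset.mem_univ _) (fun τ _ => hσσ τ)
  · rw [map_mul, map_mul, ← AlgEquiv.mul_apply, ← AlgEquiv.mul_apply, hσσ, AlgEquiv.mul_apply,
      mul_comm, CharTwo.add_self_eq_zero]
  · exact fun h => hσ1 (mul_eq_left.mp h)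

end GaloisTrace

section Trace

variable {F L : Type*} [Field F] [Field L] [Finite L] [Algebra F L] {n : ℕ}

theorem trace_pow_char (p : ℕ) [Fact p.Prime] [CharP F p] (α : L) :
    Algebra.trace F L (α ^ p) = Algebra.trace F L α ^ p := by
  have : CharP L p := charP_of_injective_algebraMap (algebraMap F L).injective p
  apply (algebraMap F L).injective
  simp only [map_pow, FiniteField.algebraMap_trace_eq_sum_pow, sum_pow_char, pow_right_comm]

variable [Finite F]

theorem trace_pow_natCard_pow (k : ℕ) (α : L) :
    Algebra.trace F L (α ^ Nat.card F ^ k) = Algebra.trace F L α := by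
  rw [← galoisFrobenius_pow_apply, Algebra.trace_eq_of_algEquiv]

theorem pow_natCard_pow_finrank (hn : finrank F L = n) (α : L) : α ^ Nat.card F ^ n = α := by
  rw [← galoisFrobenius_pow_apply, galoisFrobenius_pow_finrank hn, AlgEquiv.one_apply]

theorem isSymmetricVector_correspondingVector (hn : finrank F L = n) (α : L) :
    IsSymmetricVector (correspondingVector F n α) := by
  intro i j hij
  simp only [correspondingVector]
  rw [← trace_pow_natCard_pow (j : ℕ) (α * _), mul_pow, ← pow_mul, ← pow_add (Nat.card F), hij,
    pow_natCard_pow_finrank hn, mul_comm]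

end Trace

theorem sum_filter_odd_range_two_mul {M : Type*} [AddCommMonoid M] (f : ℕ → M) (k : ℕ) :
    ∑ i ∈ Finset.range (2 * k) with Odd i, f i = ∑ j ∈ Finset.range k, f (2 * j + 1) := by
  induction k with
  | zero => simp
  | succ k ih =>
    rw [mul_add_one, Finset.sum_filter, Finset.sum_range_succ, Finset.sum_range_succ,
      ← Finset.sum_filter, ih, Finset.sum_range_succ]
    simp [Nat.not_odd_iff_even.mpr (even_two_mul k)]

section QuadraticTower

variable {M L : Type*} [Field M] [Finite M] [Algebra (ZMod 2) M] [Field L] [Finite L]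
  [Algebra M L] [Algebra (ZMod 2) L] [IsScalarTower (ZMod 2) M L] {n : ℕ}

theorem natCard_eq_four (hM : finrank (ZMod 2) M = 2) : Nat.card M = 2 ^ 2 := by
  rw [Module.natCard_eq_pow_finrank (K := ZMod 2), hM, Nat.card_zmod]

theorem algebraMap_trace_eq_trace_add_sq (hM : finrank (ZMod 2) M = 2) (β : L) :
    algebraMap (ZMod 2) M (Algebra.trace (ZMod 2) L β) =
      Algebra.trace M L β + Algebra.trace M L β ^ 2 := by
  rw [← Algebra.trace_trace (S := M), FiniteField.algebraMap_trace_eq_sum_pow, hM]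
  simp [Finset.sum_range_succ]

theorem algebraMap_trace_mul_pow_odd (hM : finrank (ZMod 2) M = 2)
    (hL : finrank (ZMod 2) L = n) {d : ℕ} (hd : Odd d) (hdn : d ≤ n) (α : L) :
    algebraMap (ZMod 2) M (Algebra.trace (ZMod 2) L (α * α ^ 2 ^ d)) =
      Algebra.trace M L (α * α ^ 2 ^ d) + Algebra.trace M L (α * α ^ 2 ^ (n - d)) := by
  obtain ⟨e, rfl⟩ := hd
  have : CharP M 2 := charP_of_injective_algebraMap (algebraMap (ZMod 2) M).injective 2
  have hperiod : α ^ 2 ^ n = α := by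
    simpa only [Nat.card_zmod] using pow_natCard_pow_finrank hL α
  -- Squaring takes `α * α ^ 2 ^ d` to a conjugate over `M` of `α * α ^ 2 ^ (n - d)`.
  have hsq : (α * α ^ 2 ^ (2 * e + 1)) ^ 2 =
      (α * α ^ 2 ^ (n - (2 * e + 1))) ^ (2 ^ 2) ^ (e + 1) := by
    have hshift : (α ^ 2 ^ (n - (2 * e + 1))) ^ (2 ^ 2) ^ (e + 1) = α ^ 2 := by
      rw [← pow_mul, ← pow_mul, ← pow_add,
        show n - (2 * e + 1) + 2 * (e + 1) = n + 1 by omega, pow_succ 2 n, pow_mul, hperiod]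
    rw [mul_pow α (α ^ 2 ^ (n - _)), hshift, mul_pow, ← pow_mul, ← pow_mul, ← pow_succ, mul_comm]
    rfl
  rw [algebraMap_trace_eq_trace_add_sq hM, ← trace_pow_char, hsq, ← natCard_eq_four hM,
    trace_pow_natCard_pow]

theorem sum_pow_two_pow_odd_eq_trace_sq (hM : finrank (ZMod 2) M = 2)
    (hL : finrank (ZMod 2) L = n) (α : L) :
    ∑ i ∈ Finset.range n with Odd i, α ^ 2 ^ i = algebraMap M L (Algebra.trace M L α) ^ 2 := by
  have : CharP L 2 := charP_of_injective_algebraMap (algebraMap (ZMod 2) L).injective 2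
  have hn : n = 2 * finrank M L := by rw [← hL, ← finrank_mul_finrank (ZMod 2) M L, hM]
  rw [hn, sum_filter_odd_range_two_mul, FiniteField.algebraMap_trace_eq_sum_pow, sum_pow_char,
    natCard_eq_four hM]
  refine Finset.sum_congr rfl fun j _ => ?_
  rw [← pow_mul, ← pow_mul, ← pow_succ]

theorem sum_trace_mul_pow_odd_eq_one (hM : finrank (ZMod 2) M = 2)
    (hL : finrank (ZMod 2) L = n) (hn : 4 ∣ n) {α : L} (hα : Algebra.trace (ZMod 2) L α = 1) :
    ∑ i : Fin n with Odd i.val ∧ 2 * i.val < n,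
      Algebra.trace (ZMod 2) L (α * α ^ 2 ^ (i : ℕ)) = 1 := by
  set E := Algebra.trace M L α
  have hE : E + E ^ 2 = 1 := by rw [← algebraMap_trace_eq_trace_add_sq hM, hα, map_one]
  have : NeZero n := ⟨hL ▸ finrank_pos.ne'⟩
  have : CharP M 2 := charP_of_injective_algebraMap (algebraMap (ZMod 2) M).injective 2
  apply (algebraMap (ZMod 2) M).injective
  calc algebraMap (ZMod 2) M (∑ i : Fin n with Odd i.val ∧ 2 * i.val < n,
        Algebra.trace (ZMod 2) L (α * α ^ 2 ^ (i : ℕ)))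
      = ∑ i : Fin n with Odd i.val ∧ 2 * i.val < n,
          (Algebra.trace M L (α * α ^ 2 ^ (i : ℕ)) +
            Algebra.trace M L (α * α ^ 2 ^ (n - (i : ℕ)))) := by
        rw [map_sum]
        exact Finset.sum_congr rfl fun i hi =>
          algebraMap_trace_mul_pow_odd hM hL (Finset.mem_filter.mp hi).2.1 i.2.le α
    _ = ∑ i ∈ Finset.range n with Odd i, Algebra.trace M L (α * α ^ 2 ^ i) :=
        sum_odd_lt_half_add_eq hn fun i => Algebra.trace M L (α * α ^ 2 ^ i)
    _ = Algebra.trace M L (E ^ 2 • α) := by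
        rw [← map_sum, ← Finset.mul_sum, sum_pow_two_pow_odd_eq_trace_sq hM hL, mul_comm,
          Algebra.smul_def, map_pow]
    _ = algebraMap (ZMod 2) M 1 := by
        rw [map_smul, smul_eq_mul, map_one]
        linear_combination (E - 1) * hE + (E - 1) * (CharTwo.two_eq_zero : (2 : M) = 0)

end QuadraticTower

theorem exists_intermediateField_finrank_eq {F K : Type*} [Field F] [Field K] [Finite K]
    [Algebra F K] {d : ℕ} (hd : d ∣ finrank F K) :
    ∃ M : IntermediateField F K, finrank F M = d := by
  have : Finite F := Finite.of_injective _ (algebraMap F K).injective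
  have : Fact (ringChar F).Prime := ⟨CharP.prime_ringChar F⟩
  have : NeZero d := ⟨ne_zero_of_dvd_ne_zero finrank_pos.ne' hd⟩
  let E := FiniteField.Extension F (ringChar F) d
  have hE : finrank F E = d := FiniteField.finrank_extension F (ringChar F) d
  obtain ⟨f⟩ := FiniteField.nonempty_algHom_of_finrank_dvd (F := F) (K := E) (L := K) 
    (hE.symm ▸ hd)
  exact ⟨f.fieldRange, (AlgEquiv.ofInjectiveField f).toLinearEquiv.finrank_eq.symm.trans hE⟩

theorem IsNormalElement.isTwoPowerTraceVector {L : Type*} [Field L] [Finite L] [Algebra (ZMod 2) L]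
    {n : ℕ} (hL : finrank (ZMod 2) L = n) (hn : 4 ∣ n) {α : L} (hα : IsNormalElement (ZMod 2) α) :
    IsTwoPowerTraceVector (correspondingVector (ZMod 2) n α) := by
  have : CharP L 2 := charP_of_injective_algebraMap (algebraMap (ZMod 2) L).injective 2
  have hTr : Algebra.trace (ZMod 2) L α = 1 := by
    have hne := trace_ne_zero_of_linearIndependent (isNormalElement_iff_linearIndependent.mp hα)
    exact Fin.eq_one_of_ne_zero _ hne
  refine ⟨isSymmetricVector_correspondingVector hL α, fun i hi => ?_, fun i hi => ?_, ?_⟩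
  · rw [correspondingVector, hi, pow_zero, pow_one, ← sq, trace_pow_char, hTr, one_pow]
  · have hpos : 0 < (i : ℕ) := by have := i.2; omega
    rw [correspondingVector, ← galoisFrobenius_pow_apply]
    refine trace_mul_apply_eq_zero_of_sq_eq_one ?_ ?_ α
    · rw [← pow_mul, mul_comm, hi, galoisFrobenius_pow_finrank hL]
    · intro h
      have h0 := (galoisFrobenius_pow_bijective hL).injective (a₁ := i) (a₂ := ⟨0, i.pos⟩)
        (h.trans (pow_zero _).symm)
      exact hpos.ne' (congrArg Fin.val h0)
  · obtain ⟨M, hM⟩ := exists_intermediateField_finrank_eq (F := ZMod 2) (K := L) (d := 2)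
      (hL ▸ (by norm_num : 2 ∣ 4).trans hn)
    simpa only [correspondingVector, Nat.card_zmod] using sum_trace_mul_pow_odd_eq_one hM hL hn hTr

/-! ### Two-power degree -/

theorem IsTwoPowerTraceVector.neZero {n : ℕ} {a : Fin n → ZMod 2} (ha : IsTwoPowerTraceVector a) :
    NeZero n := by
  refine ⟨?_⟩
  rintro rfl
  exact zero_ne_one ha.sum_odd

theorem IsTwoPowerTraceVector.exists_sum_eq {R : Type*} [CommRing R] [CharP R 2]
    [Algebra (ZMod 2) R] {n : ℕ} {a : Fin n → ZMod 2} (ha : IsTwoPowerTraceVector a)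
    {τ : R →+* R} (hτ : ∀ z, τ (τ z) = z) {x : R} (hx : x * τ x = 1) (hxn : x ^ n = 1) :
    ∃ t, τ t = t ∧ ∑ i : Fin n, a i • x ^ (i : ℕ) = 1 + (x + τ x) + (x + τ x) ^ 2 * t := by
  have := ha.neZero
  choose t ht hpow using exists_pow_add_map_pow_eq hτ hx
  have hfixed : ∑ i : Fin n with -i = i, a i • x ^ (i : ℕ) = 1 := by
    rw [Finset.sum_eq_single_of_mem 0 (by simp), ha.zero 0 rfl, Fin.val_zero, pow_zero, one_smul]
    intro i hi hi0
    rw [ha.half i, zero_smul]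
    exact (fin_neg_eq_self_iff.mp (Finset.mem_filter.mp hi).2).resolve_left hi0
  have hpair (i : Fin n) (hi : i < -i) : a i • x ^ (i : ℕ) + a (-i) • x ^ ((-i : Fin n) : ℕ) =
      (a i * ((i : ℕ) : ZMod 2)) • (x + τ x) + (x + τ x) ^ 2 * a i • t i := by
    have hneg : ((-i : Fin n) : ℕ) = n - i := fin_val_neg_of_pos (fin_lt_neg_iff.mp hi).1
    have hinv : x ^ ((-i : Fin n) : ℕ) = τ x ^ (i : ℕ) := by
      refine left_inv_eq_right_inv (a := x ^ (i : ℕ)) ?_ (by rw [← mul_pow, hx, one_pow])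
      rw [hneg, ← pow_add, Nat.sub_add_cancel i.2.le, hxn]
    rw [← ha.symm i (-i) (by rw [hneg, Nat.add_sub_cancel' i.2.le]), hinv, ← smul_add, hpow]
    simp only [Algebra.smul_def, map_mul, map_natCast]
    ring
  refine ⟨∑ i : Fin n with i < -i, a i • t i, ?_, ?_⟩
  · simp only [map_sum, ZMod.map_smul, ht]
  · rw [sum_fin_eq_sum_add_neg, hfixed, Finset.sum_congr rfl fun i hi =>
      hpair i (Finset.mem_filter.mp hi).2, Finset.sum_add_distrib, ← Finset.sum_smul,
      sum_lt_neg_mul_natCast_eq, ha.sum_odd, one_smul, ← Finset.mul_sum, ← add_assoc]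

theorem exists_isNormalElement_correspondingVector_eq_of_two_pow {L : Type*} [Field L]
    [Finite L] [Algebra (ZMod 2) L] {s : ℕ}
    (hL : finrank (ZMod 2) L = 2 ^ s) (hs : 4 ∣ 2 ^ s)
    {a : Fin (2 ^ s) → ZMod 2} (ha : IsTwoPowerTraceVector a) :
    ∃ γ : L, IsNormalElement (ZMod 2) γ ∧ correspondingVector (ZMod 2) (2 ^ s) γ = a := by
  obtain ⟨α, hα⟩ := exists_isNormalElement (ZMod 2) L
  let x : (ZMod 2)[Gal(L/ZMod 2)] := single (galoisFrobenius (ZMod 2) L) 1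
  let τ : (ZMod 2)[Gal(L/ZMod 2)] →+* (ZMod 2)[Gal(L/ZMod 2)] :=
    RingHomClass.toRingHom (inversion (ZMod 2) Gal(L/ZMod 2))
  have hτ (z) : τ (τ z) = z := inversion_inversion z
  have hx : x * τ x = 1 := single_mul_inversion_single _
  have hxn : x ^ 2 ^ s = 1 := single_galoisFrobenius_pow_finrank hL
  have hy : IsNilpotent (x + τ x) :=
    ⟨2 ^ s, add_pow_two_pow_eq_zero hxn (by rw [← map_pow, hxn, map_one])⟩
  obtain ⟨t, ht, hsum⟩ := (hα.isTwoPowerTraceVector hL hs).exists_sum_eq hτ hx hxn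
  obtain ⟨t', ht', hsum'⟩ := ha.exists_sum_eq hτ hx hxn
  obtain ⟨g, hg⟩ := exists_mul_map_mul_eq hτ hx hy ht ht'
  have hunit : IsUnit (frobeniusSum L a) := by
    rw [frobeniusSum_eq_sum, hsum']
    exact isUnit_one_add_add_sq_mul hy t'
  rw [← hsum, ← hsum', ← frobeniusSum_eq_sum, ← frobeniusSum_eq_sum,
    ← (tracePairing_self_eq_frobeniusSum_iff hL).mpr rfl] at hg
  exact exists_isNormalElement_correspondingVector_eq hL hunit hg

/-! ### Composites of coprime degrees -/

section Product

variable {F K : Type*} [Field F] [Field K] [Algebra F K] {A B : IntermediateField F K}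

theorem sup_eq_top_of_finrank_mul_eq [FiniteDimensional F K] (hAB : A.LinearDisjoint B)
    (hK : finrank F A * finrank F B = finrank F K) : A ⊔ B = ⊤ := by
  refine IntermediateField.eq_of_le_of_finrank_eq le_top ?_
  rw [hAB.finrank_sup, hK, IntermediateField.finrank_top']

theorem trace_mul_of_linearDisjoint [FiniteDimensional F K] (hAB : A.LinearDisjoint B)
    (htop : A ⊔ B = ⊤) (x : A) (y : B) :
    Algebra.trace F K (x * y) = Algebra.trace F A x * Algebra.trace F B y := by
  have htower : Algebra.trace A K ((x : K) * y) = Algebra.trace F B y • x := by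
    rw [show (x * y : K) = x • algebraMap B K y from rfl, map_smul, hAB.trace_algebraMap htop y,
      smul_eq_mul, mul_comm, Algebra.smul_def]
  rw [← Algebra.trace_trace (S := A), htower, map_smul, smul_eq_mul, mul_comm]

variable [Finite F] [Finite K] {n m : ℕ}

theorem pow_natCard_pow_mod (hn : finrank F K = n) (k : ℕ) (x : K) :
    x ^ Nat.card F ^ (k % n) = x ^ Nat.card F ^ k := by
  rw [← galoisFrobenius_pow_apply, ← galoisFrobenius_pow_apply,
    ← pow_eq_pow_mod k (galoisFrobenius_pow_finrank hn)]

theorem mul_pow_natCard_pow (hA : finrank F A = n) (hB : finrank F B = m) (k : ℕ) (x : A) (y : B) :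
    (x * y : K) ^ Nat.card F ^ k =
      (x ^ Nat.card F ^ (k % n) : A) * (y ^ Nat.card F ^ (k % m) : B) := by
  rw [pow_natCard_pow_mod hA, pow_natCard_pow_mod hB, mul_pow]
  rfl

theorem isNormalElement_mul (hA : finrank F A = n) (hB : finrank F B = m)
    (hK : finrank F K = n * m) (hnm : n.Coprime m) {x : A} {y : B} (hx : IsNormalElement F x)
    (hy : IsNormalElement F y) : IsNormalElement F (x * y : K) := by
  subst hA hB
  have hli : LinearIndependent F fun k : Fin (finrank F K) =>
      (x * y : K) ^ Nat.card F ^ (k : ℕ) := by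
    let r (k : Fin (finrank F K)) : Fin (finrank F A) × Fin (finrank F B) :=
      (⟨k % finrank F A, Nat.mod_lt _ finrank_pos⟩, ⟨k % finrank F B, Nat.mod_lt _ finrank_pos⟩)
    have hr : Function.Injective r := by
      intro i j hij
      simp only [r, Prod.mk.injEq, Fin.mk.injEq] at hij
      have hmod := (Nat.modEq_and_modEq_iff_modEq_mul hnm).mp hij
      rw [← hK] at hmod
      exact Fin.ext (hmod.eq_of_lt_of_lt i.2 j.2)
    simp only [mul_pow_natCard_pow rfl rfl]
    exact ((IntermediateField.LinearDisjoint.of_finrank_coprime hnm).linearIndependent_mul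
      hx.1 hy.1).comp r hr
  exact ⟨hli, hli.span_eq_top_of_card_eq_finrank' (Fintype.card_fin _)⟩

theorem correspondingVector_mul (hA : finrank F A = n) (hB : finrank F B = m)
    (hAB : A.LinearDisjoint B) (htop : A ⊔ B = ⊤) (x : A) (y : B) :
    correspondingVector F (n * m) (x * y : K) = fun k : Fin (n * m) =>
      correspondingVector F n x ⟨k % n, Nat.mod_lt _ (finrank_pos.trans_eq hA)⟩ *
        correspondingVector F m y ⟨k % m, Nat.mod_lt _ (finrank_pos.trans_eq hB)⟩ := by
  funext k
  simp only [correspondingVector]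
  rw [← trace_mul_of_linearDisjoint hAB htop, mul_pow_natCard_pow hA hB, mul_mul_mul_comm]
  rfl

end Product

theorem filter_le_two_pow_pred_eq {s : ℕ} :
    (Finset.univ.filter fun i : Fin (2 ^ s) =>
      (i : ℕ) ≤ 2 ^ (s - 1) - 1 ∧ Nat.gcd (i : ℕ) 2 = 1) =
      Finset.univ.filter fun i : Fin (2 ^ s) => Odd i.val ∧ 2 * i.val < 2 ^ s := by
  ext i
  have hodd : Nat.gcd i 2 = 1 ↔ Odd i.val := Nat.coprime_two_right
  simp only [Finset.mem_filter, Finset.mem_univ, true_and, hodd, and_comm (b := Odd _),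
    and_congr_right_iff]
  intro hi
  have hpos := hi.pos
  cases s with
  | zero => omega
  | succ s =>
    have hhalf : 2 ^ (s + 1 - 1) * 2 = 2 ^ (s + 1) := (pow_succ 2 s).symm
    omega

theorem mainTheorem6 (s m : ℕ) (hs : 4 ≤ 2 ^ s) (hm : Odd m)
    (K : Type*) [Field K] [Algebra (ZMod 2) K] (hK : Nat.card K = 2 ^ (2 ^ s * m))
    (a : Fin (2 ^ s) → ZMod 2) (b : Fin m → ZMod 2)
    (ha_symm : IsSymmetricVector a)
    (ha_zero : a ⟨0, by omega⟩ = 1)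
    (ha_half : a ⟨2 ^ s / 2, by omega⟩ = 0)
    (ha_sum : ∑ i ∈ Finset.univ.filter (fun i : Fin (2 ^ s) =>
      (i : ℕ) ≤ 2 ^ (s - 1) - 1 ∧ Nat.gcd (i : ℕ) 2 = 1), a i = 1)
    (hb_symm : IsSymmetricVector b)
    (hb_coprime : IsCoprime (vectorPolynomial b) (Polynomial.X ^ m - 1)) :
    ∃ γ : K, IsNormalElement (ZMod 2) γ ∧
      correspondingVector (ZMod 2) (2 ^ s * m) γ = fun k : Fin (2 ^ s * m) =>
        a ⟨(k : ℕ) % 2 ^ s, Nat.mod_lt _ (Nat.two_pow_pos s)⟩ *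
          b ⟨(k : ℕ) % m, Nat.mod_lt _ hm.pos⟩ := by
  have : Finite K := Nat.finite_of_card_ne_zero (hK ▸ (Nat.two_pow_pos _).ne')
  have hdeg : finrank (ZMod 2) K = 2 ^ s * m := by
    rw [Module.natCard_eq_pow_finrank (K := ZMod 2), Nat.card_zmod] at hK
    exact Nat.pow_right_injective le_rfl hK
  have hcop : (2 ^ s).Coprime m := (Nat.coprime_two_left.mpr hm).pow_left s
  have ha : IsTwoPowerTraceVector a := by
    refine ⟨ha_symm, fun i hi => ?_, fun i hi => ?_, filter_le_two_pow_pred_eq ▸ ha_sum⟩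
    · rw [← ha_zero, ← Fin.eq_mk_iff_val_eq.mpr hi]
    · rw [← ha_half, ← Fin.eq_mk_iff_val_eq.mpr (by omega : (i : ℕ) = 2 ^ s / 2)]
  obtain ⟨A, hA⟩ := exists_intermediateField_finrank_eq (hdeg ▸ Dvd.intro _ rfl : 2 ^ s ∣ _)
  obtain ⟨B, hB⟩ := exists_intermediateField_finrank_eq (hdeg ▸ Dvd.intro_left _ rfl : m ∣ _)
  obtain ⟨α, hα, rfl⟩ := exists_isNormalElement_correspondingVector_eq_of_two_pow hA
    (Nat.pow_dvd_pow 2 ((Nat.pow_le_pow_iff_right (n := 2) one_lt_two).mp hs)) ha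
  obtain ⟨β, hβ, rfl⟩ := exists_isNormalElement_correspondingVector_eq_of_odd hB hm hb_symm
    hb_coprime
  have hAB : A.LinearDisjoint B := .of_finrank_coprime (by rwa [hA, hB])
  exact ⟨α * β, isNormalElement_mul hA hB hdeg hcop hα hβ, correspondingVector_mul hA hB hAB
    (sup_eq_top_of_finrank_mul_eq hAB (by rw [hA, hB, hdeg])) α β⟩
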